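/- **Setting.** Let $\Diamond$ be a quad-graph on a compact connected oriented surface of genus $g$: a finite cellular decomposition all of whose faces are quadrilaterals (obtained by gluing the sides of oriented quadrilaterals in pairs), with vertices two-coloured so that every edge joins vertices of different colours. The vertices of each colour, with the diagonals of the quadrilaterals joining them, form two dual cellular decompositions $\Gamma$ and $\Gamma^*$; $\Lambda=\Gamma\sqcup\Gamma^*$ is the double. The two diagonals of a quadrilateral are dual edges: in a face $(x,y,x',y')$, listed counterclockwise, $e=(x,x')$ has dual $e^*=(y,y')$. Let $\rho>0$ be a function on the unoriented edges of $\Lambda$ with $\rho(e^*)=1/\rho(e)$ (a discrete conformal structure). Forms are complex cochains: a $1$-form on $\Diamond$ (resp. $\Lambda$) is an odd complex function on oriented edges, and it is closed if its sum around every face of $\Diamond$ (resp. around every face of $\Lambda$, i.e. around every vertex of the opposite colour) vanishes. Define, for $1$-forms on $\Diamond$, with indices modulo $4$, $$\iint_{(x_1,x_2,x_3,x_4)}\theta\wedge\theta'=\tfrac14\sum_{k=1}^4\Big(\int_{(x_{k-1},x_k)}\theta\int_{(x_k,x_{k+1})}\theta'-\int_{(x_{k+1},x_k)}\theta\int_{(x_k,x_{k-1})}\theta'\Big),$$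 and, for $1$-forms on $\Lambda$, $$\iint_{(x,y,x',y')}\theta\wedge\theta'=\tfrac12\Big(\int_{(x,x')}\theta\int_{(y,y')}\theta'+\int_{(y,y')}\theta\int_{(x',x)}\theta'\Big).$$ In both cases $\iint_\Diamond\theta\wedge\theta'$ is the sum over all faces of $\Diamond$. *Intersection numbers.* The Hodge star on $1$-forms on $\Lambda$ is $\int_e*\alpha=-\rho(e^*)\int_{e^*}\alpha$, and $\alpha$ is harmonic if $\alpha$ and $*\alpha$ are closed. For a cycle $C$ on $\Lambda$, $\eta_C$ is the harmonic $1$-form on $\Lambda$ such that for every cycle $A$ on $\Lambda$, $\oint_A\eta_C$ is the algebraic number of times $A$ contains an edge dual to an edge of $C$ (an edge $e$ in $A$ with $e^*$ in $C$ counting $+1$). A closed path $C$ on $\Diamond$ defines cycles $C_\Gamma$ on $\Gamma$ and $C_{\Gamma^*}$ on $\Gamma^*$, homologous to $C$ on the surface: at each vertex $v$ of $C$, the cycle on the graph not containing $v$ goes from the predecessor to the successor of $v$ on $C$ along the boundary of the face dual to $v$, on the left of $C$. Then $\eta_C$ denotes a closed $1$-form on $\Diamond$ whose average is $\eta_{C_\Gamma}+\eta_{C_{\Gamma^*}}$,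 where the average of $\alpha$ has integral $\frac12\big(\int_{(x,y)}+\int_{(y,x')}+\int_{(x,y')}+\int_{(y',x')}\big)\alpha$ along the diagonal $(x,x')$ of a face $(x,y,x',y')$; it is unique up to a multiple of $d\varepsilon$, with $\varepsilon=+1$ on $\Gamma$ and $-1$ on $\Gamma^*$, which does not affect $A\cdot B:=\iint_\Diamond\eta_A\wedge\eta_B$ for closed paths $A,B$ on $\Diamond$. *Canonical dissection.* It consists of a maximal tree $T$ of $\Diamond$ and oriented edges $e_1,\dots,e_{2g}$ not in $T$, together with closed paths $\aleph_k$ in $T\cup e_k$ that run exactly once through $e_k$, in its positive direction, such that $\aleph_1,\dots,\aleph_{2g}$ form a basis of $H_1(\Diamond)$ and, for $1\le k,\ell\le g$, $$\aleph_k\cdot\aleph_\ell=0,\qquad \aleph_{k+g}\cdot\aleph_{\ell+g}=0,\qquad \aleph_k\cdot\aleph_{\ell+g}=\delta_{k,\ell}.$$ Let $\aleph^\Gamma_k=(\aleph_k)_\Gamma$, $\aleph^{\Gamma^*}_k=(\aleph_k)_{\Gamma^*}$ and, for $1\le k\le g$, $$\aleph^\Lambda_k=\aleph^\Gamma_k,\quad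 \aleph^\Lambda_{k+g}=\aleph^{\Gamma^*}_k,\quad \aleph^\Lambda_{k+2g}=\aleph^{\Gamma^*}_{k+g},\quad \aleph^\Lambda_{k+3g}=\aleph^\Gamma_{k+g}.$$ **Proposition (bilinear relations).** Let $\aleph$ be a canonical dissection. For all closed $1$-forms $\theta,\theta'$ on $\Diamond$, $$\iint_\Diamond\theta\wedge\theta'=\sum_{j=1}^{g}\Big(\oint_{\aleph_j}\theta\oint_{\aleph_{j+g}}\theta'-\oint_{\aleph_{j+g}}\theta\oint_{\aleph_j}\theta'\Big).$$ For all closed $1$-forms $\theta,\theta'$ on $\Lambda$, $$\iint_\Diamond\theta\wedge\theta'=\frac12\sum_{j=1}^{2g}\Big(\oint_{\aleph^\Lambda_j}\theta\oint_{\aleph^\Lambda_{j+2g}}\theta'-\oint_{\aleph^\Lambda_{j+2g}}\theta\oint_{\aleph^\Lambda_j}\theta'\Big).$$ -/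

import Mathlib

open scoped BigOperators

noncomputable section

/-- The oriented sides of a finite family `F` of oriented quadrilaterals: `(f, k)` is the side of
`f` going from its corner `k` to its corner `k + 1`; the corners are numbered counterclockwise,
cyclically modulo 4. -/
abbrev Dart (F : Type*) : Type _ := F × ZMod 4

/-- The `j`-th side after `d` along the boundary of the quadrilateral to the left of `d`. -/
def Dart.shift {F : Type*} (d : Dart F) (j : ZMod 4) : Dart F := (d.1, d.2 + j)

/-- A quad-graph: a cellular decomposition, all of whose faces are quadrilaterals, of a non-empty
connected closed oriented surface, with a two-colouring of the vertices. It is given by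
quadrilaterals `F` whose sides are glued in pairs with opposite orientations. The vertex set of
the colour `true` is that of the graph `Γ`, the other one is that of the dual graph `Γ*`.
The surface is compact when `F` is finite. -/
structure QuadGraph (V F : Type*) where
  /-- The same edge with the opposite orientation. -/
  rev : Dart F → Dart F
  rev_rev : ∀ d, rev (rev d) = d
  rev_ne : ∀ d, rev d ≠ d
  /-- The starting point of an oriented side (for `(f, k)`, the corner `k` of `f`). -/
  src : Dart F → V
  src_surjective : Function.Surjective src
  /-- Vertices are exactly the orbits of `d ↦ rev (d.shift (-1))`, the counterclockwise rotation
  around the starting point: every vertex has a disc as neighbourhood. -/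
  src_eq_iff : ∀ d d', src d = src d' ↔ ∃ n : ℕ, (fun e => rev (e.shift (-1)))^[n] d = d'
  color : V → Bool
  color_ne : ∀ d : Dart F, color (src (d.shift 1)) ≠ color (src d)
  nonempty : Nonempty V
  connected : ∀ u v : V,
    Relation.ReflTransGen (fun a b => ∃ d : Dart F, src d = a ∧ src (d.shift 1) = b) u v

namespace QuadGraph

variable {V F : Type*} [Fintype V] [Fintype F] (S : QuadGraph V F)

/-- The end point of an oriented side. -/
def tgt (d : Dart F) : V := S.src (d.shift 1)

/-- The next dart, counterclockwise, with the same starting point. -/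
def rot (d : Dart F) : Dart F := S.rev (d.shift (-1))

/-- The surface has genus `g`, by Euler's formula; each quadrilateral has four sides
and each edge is two sides glued together. -/
def HasGenus (_S : QuadGraph V F) (g : ℕ) : Prop :=
  (Fintype.card V : ℤ) - 2 * Fintype.card F + Fintype.card F = 2 - 2 * g

/-! ### Chains and cochains

The oriented edges of the quad-graph are the darts, the opposite of `d` being `S.rev d`.
The oriented edges of the double `Λ = Γ ⊔ Γ*` are the diagonals of the quadrilaterals: the dart
`d` also encodes the oriented diagonal from `src d` to `src (d.shift 2)`, whose opposite is
`d.shift 2` and whose dual edge (rotated by `+π/2`) is `d.shift 1`.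
In both cases, 1-chains and 1-cochains are represented by complex functions of the oriented edges
that are odd under reversal: the coefficient of an oriented edge in the chain,
resp. the integral of the form along the oriented edge. -/

open Classical in
/-- The elementary chain of an oriented edge, for the reversal `r`. -/
def edgeChain (r : Dart F → Dart F) (d : Dart F) : Dart F → ℂ :=
  Pi.single d 1 - Pi.single (r d) 1

/-- The integral of a form along a chain: the sum over unoriented edges, that is half the sum over
oriented ones. -/
def integral (c θ : Dart F → ℂ) : ℂ := (1 / 2) * ∑ d, c d * θ d

open Classical in
/-- The sum of the coefficients of a chain on the edges leaving `v` (the opposite of the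
coefficient of `v` in the boundary of the chain, for the quad-graph and for `Λ` alike). -/
def outflow (c : Dart F → ℂ) (v : V) : ℂ := ∑ d with S.src d = v, c d

/-- The 1-cycles of the quad-graph. -/
def diamCycles : Submodule ℂ (Dart F → ℂ) where
  carrier := {c | (∀ d, c (S.rev d) = -c d) ∧ ∀ v, S.outflow c v = 0}
  add_mem' := by
    rintro a b ⟨ha, ha'⟩ ⟨hb, hb'⟩
    refine ⟨fun d => by simp [ha d, hb d]; ring, fun v => ?_⟩
    have h := ha' v
    have h' := hb' v
    simp only [outflow] at h h' ⊢
    simp [Finset.sum_add_distrib, h, h']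
  zero_mem' := by simp [outflow]
  smul_mem' := by
    rintro c a ⟨ha, ha'⟩
    refine ⟨fun d => by simp [ha d], fun v => ?_⟩
    have h := ha' v
    simp only [outflow] at h ⊢
    simp [← Finset.mul_sum, h]

/-- The exact 1-chains of the quad-graph: combinations of boundaries of faces. -/
def diamBoundaries : Submodule ℂ (Dart F → ℂ) :=
  Submodule.span ℂ (Set.range fun f : F => ∑ k : ZMod 4, edgeChain S.rev (f, k))

/-- The first homology group of the quad-graph, as the space of classes of cycles
modulo boundaries. -/
def diamHomology : Submodule ℂ ((Dart F → ℂ) ⧸ S.diamBoundaries) :=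
  S.diamCycles.map S.diamBoundaries.mkQ

/-- The 1-cycles of `Λ`. -/
def IsLambdaCycle (c : Dart F → ℂ) : Prop :=
  (∀ d : Dart F, c (d.shift 2) = -c d) ∧ ∀ v, S.outflow c v = 0

/-- Closed 1-forms on the quad-graph. -/
def IsDiamClosed (θ : Dart F → ℂ) : Prop :=
  (∀ d, θ (S.rev d) = -θ d) ∧ ∀ f : F, ∑ k : ZMod 4, θ (f, k) = 0

open Classical in
/-- The coboundary of a 1-form on `Λ`, evaluated on the face dual to the vertex `v`: the boundary
of this face consists of the diagonals facing `v`. -/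
def lambdaCoboundary (θ : Dart F → ℂ) (v : V) : ℂ := ∑ d with S.src d = v, θ (d.shift 1)

/-- Closed 1-forms on `Λ`. -/
def IsLambdaClosed (θ : Dart F → ℂ) : Prop :=
  (∀ d : Dart F, θ (d.shift 2) = -θ d) ∧ ∀ v, S.lambdaCoboundary θ v = 0

/-! ### Wedge products -/

/-- The integral over the face `f` of the wedge product of two 1-forms on the quad-graph. -/
def diamWedge (α β : Dart F → ℂ) (f : F) : ℂ :=
  (1 / 4) * ∑ k : ZMod 4,
    (α (f, k - 1) * β (f, k) - α (S.rev (f, k)) * β (S.rev (f, k - 1)))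

/-- The integral over the quadrilateral `f = (x, y, x', y')` of the heterogeneous wedge product
of two 1-forms on `Λ`; here `(f, 0)`, `(f, 1)`, `(f, 2)` encode `(x, x')`, `(y, y')`, `(x', x)`. -/
def lambdaWedge (α β : Dart F → ℂ) (f : F) : ℂ :=
  (1 / 2) * (α (f, 0) * β (f, 1) + α (f, 1) * β (f, 2))

/-- The averaging map from 1-forms on the quad-graph to 1-forms on `Λ`: on the diagonal from `x`
to `x'` of `(x, y, x', y')`, half the sum of the integrals along `(x, y)`, `(y, x')`, `(x, y')`
and `(y', x')`. -/
def average (α : Dart F → ℂ) (d : Dart F) : ℂ :=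
  (1 / 2) * (α d + α (d.shift 1) + α (S.rev (d.shift 3)) + α (S.rev (d.shift 2)))

/-! ### Discrete conformal structures and harmonic forms -/

/-- A discrete conformal structure: a positive function on the unoriented edges of `Λ`, with
`ρ(e*) = 1 / ρ(e)` (applied twice, this makes `ρ` invariant under reversal). -/
structure ConformalStructure (S : QuadGraph V F) where
  ρ : Dart F → ℝ
  pos : ∀ d, 0 < ρ d
  dual : ∀ d : Dart F, ρ (d.shift 1) = 1 / ρ d

variable {S}

/-- The Hodge star on 1-forms on `Λ`. -/
def ConformalStructure.star (R : S.ConformalStructure) (α : Dart F → ℂ) (d : Dart F) : ℂ :=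
  -(R.ρ (d.shift 1) : ℂ) * α (d.shift 1)

/-- The algebraic number of times the chain `A` of `Λ` contains an edge dual to an edge of the
chain `C` of `Λ`: an edge `e` of `A` whose dual `e*` (`e` rotated by `+π/2`) is in `C` counts
positively. -/
def crossingNumber (A C : Dart F → ℂ) : ℂ := (1 / 2) * ∑ d : Dart F, A d * C (d.shift 1)

/-- `η` is the harmonic (closed and co-closed) 1-form `η_C` on `Λ` associated with the cycle `C`
of `Λ`: its integral along every cycle `A` is the algebraic number of times `A` crosses `C`. -/
def ConformalStructure.IsLambdaEta (R : S.ConformalStructure) (C η : Dart F → ℂ) : Prop :=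
  S.IsLambdaClosed η ∧ S.IsLambdaClosed (R.star η) ∧
    ∀ A, S.IsLambdaCycle A → integral A η = crossingNumber A C

/-- The harmonic form `η_C` on `Λ`. -/
def ConformalStructure.lambdaEta (R : S.ConformalStructure) (C : Dart F → ℂ) : Dart F → ℂ :=
  Classical.epsilon (R.IsLambdaEta C)

/-! ### Closed paths and their companions on the two graphs -/

variable (S)

/-- A closed path on the quad-graph: a cyclic sequence of `len + 1` consecutive oriented edges
(addition in `Fin (len + 1)` is cyclic). -/
structure ClosedPath where
  len : ℕ
  dart : Fin (len + 1) → Dart F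
  closed : ∀ i, S.tgt (dart i) = S.src (dart (i + 1))

variable {S}

/-- The 1-chain of a closed path. -/
def ClosedPath.chain (C : S.ClosedPath) : Dart F → ℂ := ∑ i, edgeChain S.rev (C.dart i)

/-- The number of quadrilaterals on the left of a path entering a vertex through `d` and leaving
it through `d'`: the number of counterclockwise rotations from `d'` to the reverse of `d`
(none if the path turns back). -/
def leftTurn (d d' : Dart F) : ℕ := sInf {n : ℕ | S.rot^[n] d' = S.rev d}

/-- The cycle `C_Γ` (`b = true`) or `C_Γ*` (`b = false`) which follows the closed path `C` on its
left. At each vertex `v` of `C` of the other colour, it follows the boundary of the face of `Λ`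
dual to `v`, from the vertex preceding `v` on `C` to the vertex following `v` on `C`, through
the quadrilaterals on the left of `C`; in the `n`-th quadrilateral, counted counterclockwise
from the outgoing edge, it runs clockwise along the diagonal facing `v`. -/
def ClosedPath.leftCycle (C : S.ClosedPath) (b : Bool) : Dart F → ℂ :=
  ∑ i, if S.color (S.tgt (C.dart i)) = b then 0 else
    ∑ n ∈ Finset.range (leftTurn (S := S) (C.dart i) (C.dart (i + 1))),
      edgeChain (fun d => d.shift 2) ((S.rot^[n] (C.dart (i + 1))).shift (-1))

/-- `η` is a closed 1-form on the quad-graph that averages to `η_{C_Γ} + η_{C_Γ*}`. -/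
def ConformalStructure.IsDiamEta (R : S.ConformalStructure) (C : S.ClosedPath)
    (η : Dart F → ℂ) : Prop :=
  S.IsDiamClosed η ∧
    S.average η = R.lambdaEta (C.leftCycle true) + R.lambdaEta (C.leftCycle false)

/-- The closed form `η_C` on the quad-graph, unique up to a multiple of `dε`, where `ε` is `1` on
`Γ` and `-1` on `Γ*`. -/
def ConformalStructure.diamEta (R : S.ConformalStructure) (C : S.ClosedPath) : Dart F → ℂ :=
  Classical.epsilon (R.IsDiamEta C)

/-- The intersection number of two closed paths on the quad-graph. -/
def ConformalStructure.intersection (R : S.ConformalStructure) (A B : S.ClosedPath) : ℂ :=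
  ∑ f, S.diamWedge (R.diamEta A) (R.diamEta B) f

/-! ### Canonical dissections -/

variable (S)

/-- `T` is (the set of both orientations of the edges of) a maximal tree: it carries no non-zero
cycle, and every edge added to it creates one. -/
def IsMaximalTree (T : Set (Dart F)) : Prop :=
  (∀ d ∈ T, S.rev d ∈ T) ∧
  (∀ z ∈ S.diamCycles, (∀ d, d ∉ T → z d = 0) → z = 0) ∧
  ∀ e, e ∉ T → ∃ z ∈ S.diamCycles, z ≠ 0 ∧ ∀ d, d ∉ T → d ≠ e → d ≠ S.rev e → z d = 0

variable {S}

/-- A canonical dissection of a quad-graph of genus `g`. The index `Sum.inl j` stands for the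
`j`-th and `Sum.inr j` for the `(j + g)`-th element. -/
structure CanonicalDissection (R : S.ConformalStructure) (g : ℕ) where
  /-- A maximal tree. -/
  tree : Set (Dart F)
  isMaximalTree : S.IsMaximalTree tree
  /-- The additional oriented edges. -/
  edge : Fin g ⊕ Fin g → Dart F
  edge_notMem : ∀ k, edge k ∉ tree
  /-- The `k`-th cycle is a closed path in the tree and the `k`-th edge, which runs exactly once
  through this edge. -/
  cycle : Fin g ⊕ Fin g → S.ClosedPath
  cycle_mem : ∀ k i, (cycle k).dart i = edge k ∨ (cycle k).dart i ∈ tree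
  cycle_edge : ∀ k, ∃! i, (cycle k).dart i = edge k
  /-- The cycles form a basis of the homology. -/
  linearIndependent : LinearIndependent ℂ fun k => S.diamBoundaries.mkQ (cycle k).chain
  span_eq : Submodule.span ℂ (Set.range fun k => S.diamBoundaries.mkQ (cycle k).chain) =
    S.diamHomology
  /-- The intersection numbers. -/
  inl_inl : ∀ k l, R.intersection (cycle (.inl k)) (cycle (.inl l)) = 0
  inr_inr : ∀ k l, R.intersection (cycle (.inr k)) (cycle (.inr l)) = 0
  inl_inr : ∀ k l, R.intersection (cycle (.inl k)) (cycle (.inr l)) = if k = l then 1 else 0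

/-- The `4g` cycles on `Λ`, in the order `Γ_k`, `Γ*_k`, `Γ*_{k+g}`, `Γ_{k+g}` for `1 ≤ k ≤ g`. The
index `Sum.inl j` stands for the `j`-th and `Sum.inr j` for the `(j + 2g)`-th cycle,
where `j` in turn runs through `Fin g ⊕ Fin g`. -/
def CanonicalDissection.lambdaCycle {R : S.ConformalStructure} {g : ℕ}
    (A : CanonicalDissection R g) : (Fin g ⊕ Fin g) ⊕ (Fin g ⊕ Fin g) → Dart F → ℂ
  | .inl (.inl k) => (A.cycle (.inl k)).leftCycle true
  | .inl (.inr k) => (A.cycle (.inl k)).leftCycle false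
  | .inr (.inl k) => (A.cycle (.inr k)).leftCycle false
  | .inr (.inr k) => (A.cycle (.inr k)).leftCycle true

end QuadGraph

end

noncomputable section

/-! Averaging sends closed forms on the quad-graph to closed forms on `Λ` and preserves the wedge
product face by face (`IsDiamClosed.diamWedge_eq`), so everything can be computed on `Λ`. There a
wedge product multiplies values on dual diagonals, which have opposite colours. Its integral
therefore splits into two halves (`colorPairing`), and Stokes' formula holds for each half
separately (`colorPairing_lambdaExact`).

Up to an exact form, `η_C` is the explicit form `C.leftForm`, whose average counts crossings with
the two left cycles; this rests on Hodge decomposition for weighted graphs. Hence each half of the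
pairing of `η_C` with `θ` is half the period of `θ` along `C`
(`ClosedPath.colorPairing_of_average`). With `θ` itself some `η_B`, intersection numbers become
periods. The symplectic intersection matrix then gives a combination of the `η` with the periods of
`θ`, hence equal to `θ` up to an exact form, and pairing with `θ'` yields the relation one colour at
a time (`CanonicalDissection.colorPairing_average`).

A closed form on `Λ` need not be an average, but on the diagonals of one colour it agrees with one
(`IsLambdaClosed.exists_average_eq`). Each half of the pairing reads each form on a single colour
only, so the relation for one colour, applied to these lifts, gives the second statement. -/

theorem Dart.shift_shift {F : Type*} (d : Dart F) (j k : ZMod 4) :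
    (d.shift j).shift k = d.shift (j + k) := by
  simp [Dart.shift, add_assoc]

theorem Dart.shift_zero {F : Type*} (d : Dart F) : d.shift 0 = d := by
  simp [Dart.shift]

/-- The bijection of the oriented sides given by a shift. -/
def Dart.shiftEquiv {F : Type*} (j : ZMod 4) : Dart F ≃ Dart F where
  toFun d := d.shift j
  invFun d := d.shift (-j)
  left_inv d := by simp [Dart.shift_shift, Dart.shift_zero]
  right_inv d := by simp [Dart.shift_shift, Dart.shift_zero]

theorem Dart.shift_eq_iff {F : Type*} (d e : Dart F) (j : ZMod 4) :
    d.shift j = e ↔ d = e.shift (-j) :=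
  ⟨fun h => by simp [← h, Dart.shift_shift, Dart.shift_zero],
    fun h => by simp [h, Dart.shift_shift, Dart.shift_zero]⟩

theorem Dart.sum_shift {F M : Type*} [Fintype F] [AddCommMonoid M] (j : ZMod 4)
    (h : Dart F → M) : ∑ d : Dart F, h (d.shift j) = ∑ d, h d :=
  (Dart.shiftEquiv j).sum_comp h

theorem ZMod.sum_univ_four {M : Type*} [AddCommMonoid M] (h : ZMod 4 → M) :
    ∑ k, h k = h 0 + h 1 + h 2 + h 3 :=
  Fin.sum_univ_four h

/-! ### Potential differences on a finite graph -/

namespace QuadGraph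

section PotentialDiff

variable {D V : Type*}

/-- The coboundary of a function on the vertices of a graph with oriented edges `D`, starting
points `s` and reversal `r`. -/
def potentialDiff (r : D → D) (s : D → V) (f : V → ℂ) (d : D) : ℂ := f (s (r d)) - f (s d)

theorem potentialDiff_odd {r : D → D} (hr : Function.Involutive r) (s : D → V) (f : V → ℂ) (d : D) :
    potentialDiff r s f (r d) = -potentialDiff r s f d := by
  simp [potentialDiff, hr d]

variable [Fintype D]

open scoped Classical in
/-- A co-closed 1-form without periods vanishes. -/
theorem eq_zero_of_coclosed {r : D → D} {s : D → V}
    {w : D → ℝ} (hw : ∀ d, 0 < w d) (hwr : ∀ d, w (r d) = w d) {β : D → ℂ}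
    (hβ : ∀ d, β (r d) = -β d) (h : ∀ v, ∑ d with s d = v, (w d : ℂ) * β d = 0)
    (hA : ∀ A : D → ℂ, (∀ d, A (r d) = -A d) → (∀ v, ∑ d with s d = v, A d = 0) →
      ∑ d, A d * β d = 0) : β = 0 := by
  -- The weights being real, the conjugate of `w * β` is again a cycle; testing `β` against it gives
  -- a weighted sum of squared norms.
  have h0 := hA (fun d => w d * (starRingEnd ℂ) (β d)) (fun d => by simp [hwr, hβ]) fun v => by
    have := congrArg (starRingEnd ℂ) (h v)
    simpa only [map_sum, map_mul, Complex.conj_ofReal, map_zero] using this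
  have h1 : ∑ d, w d * ‖β d‖ ^ 2 = 0 := by
    have : ((∑ d, w d * ‖β d‖ ^ 2 : ℝ) : ℂ) = 0 := by
      rw [← h0]
      push_cast
      exact Finset.sum_congr rfl fun d _ => by rw [mul_assoc, Complex.conj_mul']
    exact_mod_cast this
  funext d
  have := (Finset.sum_eq_zero_iff_of_nonneg fun d _ =>
    mul_nonneg (hw d).le (sq_nonneg ‖β d‖)).1 h1 d (Finset.mem_univ d)
  simpa [(hw d).ne'] using this

variable [Fintype V]

open scoped Classical in
theorem sum_mul_comp (s : D → V) (f : V → ℂ) (A : D → ℂ) :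
    ∑ d, f (s d) * A d = ∑ v, f v * ∑ d with s d = v, A d := by
  rw [← Finset.sum_fiberwise Finset.univ s]
  refine Finset.sum_congr rfl fun v _ => ?_
  rw [Finset.mul_sum]
  exact Finset.sum_congr rfl fun d hd => by rw [(Finset.mem_filter.1 hd).2]

open scoped Classical in
-- Summation by parts; the factor `2` comes from summing over both orientations of each edge.
theorem sum_potentialDiff_mul {r : D → D} (hr : Function.Involutive r) (s : D → V) (f : V → ℂ)
    (A : D → ℂ) (hA : ∀ d, A (r d) = -A d) :
    ∑ d, potentialDiff r s f d * A d = -2 * ∑ v, f v * ∑ d with s d = v, A d := by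
  have h : ∑ d, f (s (r d)) * A d = -∑ d, f (s d) * A d := by
    rw [← Equiv.sum_comp hr.toPerm, ← Finset.sum_neg_distrib]
    exact Finset.sum_congr rfl fun d _ => by
      rw [Function.Involutive.coe_toPerm, hr d, hA, mul_neg]
  simp only [potentialDiff, sub_mul, Finset.sum_sub_distrib, h]
  rw [sum_mul_comp]
  ring

open scoped Classical in
/-- Every 1-form differs from a co-closed one by an exact one. -/
theorem exists_sub_potentialDiff_coclosed {r : D → D} (hr : Function.Involutive r) (s : D → V)
    {w : D → ℝ} (hw : ∀ d, 0 < w d) (hwr : ∀ d, w (r d) = w d) {β : D → ℂ}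
    (hβ : ∀ d, β (r d) = -β d) :
    ∃ f : V → ℂ, ∀ v, ∑ d with s d = v, (w d : ℂ) * (β d - potentialDiff r s f d) = 0 := by
  -- Scaling by `√w` turns the weighted inner product into the standard one, so `f` comes from the
  -- orthogonal projection of `β` onto exact forms. Orthogonality to the coboundary of the indicator
  -- of `v` is co-closedness at `v`.
  let T : (V → ℂ) →ₗ[ℂ] EuclideanSpace ℂ D :=
    { toFun := fun f => WithLp.toLp 2 fun d => (√(w d) : ℂ) * potentialDiff r s f d
      map_add' := fun f g => by ext d; simp [potentialDiff]; ring
      map_smul' := fun c f => by ext d; simp [potentialDiff]; ring }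
  let x : EuclideanSpace ℂ D := WithLp.toLp 2 fun d => (√(w d) : ℂ) * β d
  obtain ⟨f, hf⟩ := (LinearMap.range T).starProjection_apply_mem x
  have hx := (LinearMap.range T).sub_starProjection_mem_orthogonal x
  rw [← hf] at hx
  refine ⟨f, fun v => ?_⟩
  have h := (Submodule.mem_orthogonal _ _).1 hx _ (LinearMap.mem_range_self T (Pi.single v 1))
  have h' : ∑ d, potentialDiff r s (Pi.single v 1) d * ((w d : ℂ) * (β d - potentialDiff r s f d)) = 0 := by
    rw [← h, PiLp.inner_apply]
    refine Finset.sum_congr rfl fun d _ => ?_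
    have hs : ((√(w d) : ℝ) : ℂ) * (√(w d) : ℝ) = w d := by
      rw [← Complex.ofReal_mul, Real.mul_self_sqrt (hw d).le]
    have hc : (starRingEnd ℂ) (potentialDiff r s (Pi.single v 1) d) =
        potentialDiff r s (Pi.single v 1) d := by
      simp only [potentialDiff, Pi.single_apply]
      split_ifs <;> simp
    simp only [T, x, LinearMap.coe_mk, AddHom.coe_mk, PiLp.sub_apply, RCLike.inner_apply, map_mul,
      hc, Complex.conj_ofReal]
    rw [← hs]
    ring
  rw [sum_potentialDiff_mul hr s _ _ fun d => by rw [hwr, hβ, potentialDiff_odd hr]; ring] at h'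
  simpa [Pi.single_apply] using h'

open scoped Classical in
/-- A 1-form without periods is exact. -/
theorem exists_eq_potentialDiff {r : D → D} (hr : Function.Involutive r) (s : D → V) {β : D → ℂ}
    (hβ : ∀ d, β (r d) = -β d)
    (hA : ∀ A : D → ℂ, (∀ d, A (r d) = -A d) → (∀ v, ∑ d with s d = v, A d = 0) →
      ∑ d, A d * β d = 0) : ∃ f, β = potentialDiff r s f := by
  obtain ⟨f, hf⟩ := exists_sub_potentialDiff_coclosed hr s (w := fun _ => 1) (by simp) (by simp) hβ
  refine ⟨f, sub_eq_zero.1 (eq_zero_of_coclosed (r := r) (s := s) (w := fun _ => 1) (by simp)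
    (by simp) (fun d => ?_) hf fun A h1 h2 => ?_)⟩
  · simp [hβ, potentialDiff_odd hr]; ring
  · have h3 := sum_potentialDiff_mul hr s f A h1
    simp only [h2, mul_zero, Finset.sum_const_zero] at h3
    simp only [Pi.sub_apply, mul_sub, Finset.sum_sub_distrib, hA A h1 h2, zero_sub, neg_eq_zero]
    rw [← h3]
    exact Finset.sum_congr rfl fun d _ => mul_comm _ _
end PotentialDiff

/-! ### Rotation around a vertex -/

section Rotation

variable {V F : Type*} (S : QuadGraph V F)

theorem rev_involutive : Function.Involutive S.rev := S.rev_rev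

theorem src_rot (d : Dart F) : S.src (S.rot d) = S.src d :=
  ((S.src_eq_iff d (S.rot d)).2 ⟨1, rfl⟩).symm

theorem rot_shift_one (d : Dart F) : S.rot (d.shift 1) = S.rev d := by
  simp [rot, Dart.shift_shift, Dart.shift_zero]

theorem rev_rot (d : Dart F) : S.rev (S.rot d) = d.shift (-1) := by
  simp [rot, S.rev_rev]

theorem src_rev (d : Dart F) : S.src (S.rev d) = S.tgt d := by
  rw [← rot_shift_one, src_rot, tgt]

/-- The rotation around the starting points as a permutation. -/
def rotEquiv : Dart F ≃ Dart F where
  toFun := S.rot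
  invFun d := (S.rev d).shift 1
  left_inv d := by simp [rev_rot, Dart.shift_shift, Dart.shift_zero]
  right_inv d := by rw [rot_shift_one, S.rev_rev]

theorem exists_rot_iterate {d d' : Dart F} (h : S.src d = S.src d') :
    ∃ n : ℕ, S.rot^[n] d = d' :=
  (S.src_eq_iff d d').1 h

theorem src_rot_iterate (n : ℕ) (d : Dart F) : S.src (S.rot^[n] d) = S.src d :=
  ((S.src_eq_iff _ _).2 ⟨n, rfl⟩).symm

/-- Vertices are single rotation orbits, so the set in `leftTurn` is non-empty and its infimum is
attained, not a default value. -/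
theorem rot_iterate_leftTurn {d d' : Dart F} (h : S.tgt d = S.src d') :
    S.rot^[leftTurn (S := S) d d'] d' = S.rev d :=
  Nat.sInf_mem (s := {n : ℕ | S.rot^[n] d' = S.rev d})
    (S.exists_rot_iterate (by rw [src_rev, h]))

theorem color_tgt (d : Dart F) : S.color (S.tgt d) = !S.color (S.src d) :=
  Bool.eq_not.2 (S.color_ne d)

theorem color_shift_one (d : Dart F) : S.color (S.src (d.shift 1)) = !S.color (S.src d) :=
  S.color_tgt d

theorem color_shift_two (d : Dart F) : S.color (S.src (d.shift 2)) = S.color (S.src d) := by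
  rw [show d.shift 2 = (d.shift 1).shift 1 from (d.shift_shift 1 1).symm, color_shift_one,
    color_shift_one, Bool.not_not]

theorem color_shift_neg_one (d : Dart F) :
    S.color (S.src (d.shift (-1))) = !S.color (S.src d) := by
  rw [show d.shift (-1) = (d.shift 2).shift 1 from (d.shift_shift 2 1).symm, color_shift_one,
    color_shift_two]

variable {S}

/-- The sum over the edges to the left of a closed path at its `i`-th corner telescopes. -/
theorem ClosedPath.sum_leftTurn_sub {M : Type*} [AddCommGroup M] (C : S.ClosedPath)
    (i : Fin (C.len + 1)) (h : Dart F → M) :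
    ∑ n ∈ Finset.range (leftTurn (S := S) (C.dart i) (C.dart (i + 1))),
      (h (S.rot (S.rot^[n] (C.dart (i + 1)))) - h (S.rot^[n] (C.dart (i + 1)))) =
      h (S.rev (C.dart i)) - h (C.dart (i + 1)) := by
  simp only [← Function.iterate_succ_apply']
  rw [Finset.sum_range_sub fun n => h (S.rot^[n] (C.dart (i + 1))),
    S.rot_iterate_leftTurn (C.closed i), Function.iterate_zero_apply]

theorem ClosedPath.sum_succ {M : Type*} [AddCommMonoid M] (C : S.ClosedPath)
    (h : Fin (C.len + 1) → M) : ∑ i, h (i + 1) = ∑ i, h i :=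
  Equiv.sum_comp (Equiv.addRight (1 : Fin (C.len + 1))) h

theorem ClosedPath.color_succ (C : S.ClosedPath) (i : Fin (C.len + 1)) :
    S.color (S.src (C.dart (i + 1))) = S.color (S.tgt (C.dart i)) := by
  rw [C.closed]

/-- The sum over the edges to the left of a closed path telescopes. -/
theorem ClosedPath.sum_sum_leftTurn_sub {M : Type*} [AddCommGroup M] (C : S.ClosedPath)
    (h : Dart F → M) :
    ∑ i, ∑ n ∈ Finset.range (leftTurn (S := S) (C.dart i) (C.dart (i + 1))),
      (h (S.rot (S.rot^[n] (C.dart (i + 1)))) - h (S.rot^[n] (C.dart (i + 1)))) =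
      ∑ i, (h (S.rev (C.dart i)) - h (C.dart i)) := by
  simp only [C.sum_leftTurn_sub, Finset.sum_sub_distrib]
  rw [C.sum_succ fun i => h (C.dart i)]

end Rotation

/-! ### Elementary chains -/

section EdgeChain

variable {V F : Type*} (S : QuadGraph V F)

theorem shift_two_involutive : Function.Involutive fun d : Dart F => d.shift 2 := fun d => by
  simp only [Dart.shift_shift]
  exact d.shift_zero

open scoped Classical in
theorem edgeChain_apply (r : Dart F → Dart F) (d x : Dart F) :
    edgeChain r d x = (if x = d then 1 else 0) - (if x = r d then 1 else 0) := by
  simp [edgeChain, Pi.single_apply]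

theorem edgeChain_apply_rev {r : Dart F → Dart F} (hr : Function.Involutive r) (d x : Dart F) :
    edgeChain r d (r x) = -edgeChain r d x := by
  classical
  simp only [edgeChain_apply, hr.eq_iff, hr d]
  ring

theorem edgeChain_rev {r : Dart F → Dart F} (hr : Function.Involutive r) (d : Dart F) :
    edgeChain r (r d) = -edgeChain r d := by
  simp [edgeChain, hr d]

/-- The elementary chain of the diagonal encoded by `d`. -/
abbrev diagChain (d : Dart F) : Dart F → ℂ := edgeChain (fun e => e.shift 2) d

theorem diagChain_shift_two (d : Dart F) : diagChain (d.shift 2) = -diagChain d :=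
  edgeChain_rev shift_two_involutive d

theorem diagChain_shift_neg_one (d : Dart F) : diagChain (d.shift (-1)) = -diagChain (d.shift 1) := by
  rw [← diagChain_shift_two, Dart.shift_shift]
  rfl

theorem diagChain_shift (d x : Dart F) (j : ZMod 4) :
    diagChain (d.shift j) (x.shift j) = diagChain d x := by
  classical
  simp only [edgeChain_apply, Dart.shift_eq_iff x, Dart.shift_shift]
  simp [add_comm, add_left_comm, Dart.shift_zero]

theorem integral_edgeChain [Fintype F] {r : Dart F → Dart F} {θ : Dart F → ℂ}
    (hθ : ∀ d, θ (r d) = -θ d) (d : Dart F) : integral (edgeChain r d) θ = θ d := by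
  classical
  simp [integral, edgeChain_apply, sub_mul, Finset.sum_sub_distrib, hθ]
  ring

/-- Integration of a form, as a linear function of the chain. -/
def integralLin [Fintype F] (θ : Dart F → ℂ) : (Dart F → ℂ) →ₗ[ℂ] ℂ where
  toFun c := integral c θ
  map_add' a b := by simp [integral, add_mul, Finset.sum_add_distrib, mul_add]
  map_smul' a b := by simp [integral, mul_assoc, Finset.mul_sum, mul_left_comm]

/-- The averaging map as a linear map. -/
def averageLin : (Dart F → ℂ) →ₗ[ℂ] (Dart F → ℂ) where
  toFun := S.average
  map_add' a b := by funext d; simp [average]; ring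
  map_smul' a b := by funext d; simp [average]; ring

theorem averageLin_apply (α : Dart F → ℂ) : S.averageLin α = S.average α := rfl

theorem average_eq_of_odd {α : Dart F → ℂ} (hα : ∀ d, α (S.rev d) = -α d) (d : Dart F) :
    S.average α d = (1 / 2) * (α d + α (d.shift 1) - α (d.shift 2) - α (d.shift 3)) := by
  simp only [average, hα]
  ring

theorem average_edgeChain (d : Dart F) :
    S.average (edgeChain S.rev d) = (1 / 2 : ℂ) • (diagChain d - diagChain (d.shift 1) -
      diagChain (S.rev d) + diagChain ((S.rev d).shift 1)) := by
  classical
  funext x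
  rw [S.average_eq_of_odd (edgeChain_apply_rev S.rev_involutive d)]
  simp only [edgeChain_apply, Dart.shift_eq_iff x, Pi.smul_apply, Pi.sub_apply, Pi.add_apply,
    Dart.shift_shift, smul_eq_mul, show (-1 : ZMod 4) = 3 from rfl,
    show (-2 : ZMod 4) = 2 from rfl, show (-3 : ZMod 4) = 1 from rfl,
    show (1 + 2 : ZMod 4) = 3 from rfl]
  ring

end EdgeChain

/-! ### Closed forms -/

section ClosedForms

variable {V F : Type*} (S : QuadGraph V F)

/-- The space of closed 1-forms on the quad-graph. -/
def diamClosed : Submodule ℂ (Dart F → ℂ) where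
  carrier := {θ | S.IsDiamClosed θ}
  add_mem' {a b} ha hb := ⟨fun d => by simp [ha.1 d, hb.1 d]; ring, fun f => by
    simp [Finset.sum_add_distrib, ha.2 f, hb.2 f]⟩
  zero_mem' := ⟨by simp, by simp⟩
  smul_mem' c a ha := ⟨fun d => by simp [ha.1 d], fun f => by simp [← Finset.mul_sum, ha.2 f]⟩

variable {S}

theorem IsDiamClosed.sum_shift {θ : Dart F → ℂ} (hθ : S.IsDiamClosed θ) (d : Dart F) :
    θ d + θ (d.shift 1) + θ (d.shift 2) + θ (d.shift 3) = 0 := by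
  have h := hθ.2 d.1
  rw [← Equiv.sum_comp (Equiv.addLeft d.2), ZMod.sum_univ_four] at h
  simpa [Dart.shift] using h

theorem isDiamClosed_of_shift {θ : Dart F → ℂ} (h1 : ∀ d, θ (S.rev d) = -θ d)
    (h2 : ∀ d, θ d + θ (d.shift 1) + θ (d.shift 2) + θ (d.shift 3) = 0) : S.IsDiamClosed θ :=
  ⟨h1, fun f => by simpa [ZMod.sum_univ_four, Dart.shift] using h2 (f, 0)⟩

/-- The average of a closed form along a diagonal. -/
theorem IsDiamClosed.average_eq {θ : Dart F → ℂ} (hθ : S.IsDiamClosed θ) (d : Dart F) :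
    S.average θ d = θ d + θ (d.shift 1) := by
  rw [average_eq_of_odd S hθ.1]
  linear_combination (-1 / 2) * hθ.sum_shift d

/-- The diagonal facing the start of `d` is homologous to the two sides through that corner. The
average is thus a difference between consecutive darts of a rotation, and sums around a vertex
telescope. -/
theorem IsDiamClosed.average_shift_one {θ : Dart F → ℂ} (hθ : S.IsDiamClosed θ) (d : Dart F) :
    S.average θ (d.shift 1) = θ (S.rot d) - θ d := by
  have h : θ (S.rot d) = -θ (d.shift 3) := by rw [← hθ.1]; rfl
  rw [hθ.average_eq, h, Dart.shift_shift, show (1 + 1 : ZMod 4) = 2 from rfl]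
  linear_combination hθ.sum_shift d

theorem IsDiamClosed.average_odd {θ : Dart F → ℂ} (hθ : S.IsDiamClosed θ) (d : Dart F) :
    S.average θ (d.shift 2) = -S.average θ d := by
  rw [hθ.average_eq, hθ.average_eq, Dart.shift_shift, show (2 + 1 : ZMod 4) = 3 from rfl]
  linear_combination hθ.sum_shift d

theorem isDiamClosed_potentialDiff (f : V → ℂ) :
    S.IsDiamClosed (potentialDiff S.rev S.src f) := by
  refine isDiamClosed_of_shift (fun d => potentialDiff_odd S.rev_involutive _ _ _) fun d => ?_
  simp only [potentialDiff, src_rev, tgt, Dart.shift_shift, show (1 + 1 : ZMod 4) = 2 from rfl,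
    show (2 + 1 : ZMod 4) = 3 from rfl, show (3 + 1 : ZMod 4) = 0 from rfl, Dart.shift_zero]
  ring

theorem average_potentialDiff (f : V → ℂ) :
    S.average (potentialDiff S.rev S.src f) =
      potentialDiff (fun d => d.shift 2) S.src f := by
  funext d
  rw [(isDiamClosed_potentialDiff f).average_eq]
  simp [potentialDiff, src_rev, tgt, Dart.shift_shift, show (1 + 1 : ZMod 4) = 2 from rfl]

variable [Fintype F]

theorem IsDiamClosed.average {θ : Dart F → ℂ} (hθ : S.IsDiamClosed θ) :
    S.IsLambdaClosed (S.average θ) := by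
  classical
  refine ⟨hθ.average_odd, fun v => ?_⟩
  simp only [lambdaCoboundary, hθ.average_shift_one, Finset.sum_sub_distrib]
  rw [sub_eq_zero, Finset.sum_filter, Finset.sum_filter]
  refine Eq.trans (Finset.sum_congr rfl fun d _ => ?_)
    (Equiv.sum_comp S.rotEquiv fun d => if S.src d = v then θ d else 0)
  simp only [rotEquiv, Equiv.coe_fn_mk, src_rot]

end ClosedForms

/-! ### The form crossing a closed path -/

section LeftForm

variable {V F : Type*} {S : QuadGraph V F}

/-- The closed form counting the crossings with a closed path, pushed to its left. -/
def ClosedPath.leftForm (C : S.ClosedPath) : Dart F → ℂ :=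
  -- When the path does not turn back, `n = 0` is the outgoing edge; it cancels against `C.chain`,
  -- leaving the edges strictly to the left.
  C.chain - ∑ i, ∑ n ∈ Finset.range (leftTurn (S := S) (C.dart i) (C.dart (i + 1))),
    edgeChain S.rev (S.rot^[n] (C.dart (i + 1)))

open scoped Classical in
theorem sum_face_edgeChain (d : Dart F) (f : F) :
    ∑ k : ZMod 4, edgeChain S.rev d (f, k) =
      (if f = d.1 then 1 else 0) - (if f = (S.rev d).1 then 1 else 0) := by
  have h : ∀ e : Dart F, ∑ k : ZMod 4, (if (f, k) = e then (1 : ℂ) else 0) =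
      if f = e.1 then 1 else 0 := by
    rintro ⟨f', k'⟩
    by_cases hf : f = f' <;> simp [Prod.ext_iff, hf]
  simp only [edgeChain_apply, Finset.sum_sub_distrib, h]

/-- The faces on the two sides of a spoke are shared with its neighbours under rotation, so the face
sums over the left edges telescope to those of the path itself. -/
theorem ClosedPath.isDiamClosed_leftForm (C : S.ClosedPath) : S.IsDiamClosed C.leftForm := by
  classical
  refine ⟨fun d => ?_, fun f => ?_⟩
  · simp only [leftForm, chain, Pi.sub_apply, Finset.sum_apply,
      edgeChain_apply_rev S.rev_involutive, Finset.sum_neg_distrib]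
    ring
  · have h := C.sum_sum_leftTurn_sub fun d => if f = (S.rev d).1 then (1 : ℂ) else 0
    simp only [rev_rot, S.rev_rev] at h
    have h' : ∀ d : Dart F, (d.shift (-1)).1 = d.1 := fun _ => rfl
    simp only [leftForm, chain, Pi.sub_apply, Finset.sum_apply, Finset.sum_sub_distrib]
    rw [Finset.sum_comm, Finset.sum_comm (t := Finset.univ)]
    simp only [Finset.sum_comm (s := (Finset.univ : Finset (ZMod 4))), sum_face_edgeChain]
    simp only [h'] at h
    rw [h, sub_self]

/-- The cycles on the left of a closed path, on both graphs. -/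
theorem ClosedPath.leftCycle_add (C : S.ClosedPath) :
    C.leftCycle true + C.leftCycle false =
      ∑ i, ∑ n ∈ Finset.range (leftTurn (S := S) (C.dart i) (C.dart (i + 1))),
        diagChain ((S.rot^[n] (C.dart (i + 1))).shift (-1)) := by
  simp only [leftCycle, ← Finset.sum_add_distrib]
  refine Finset.sum_congr rfl fun i _ => ?_
  cases S.color (S.tgt (C.dart i)) <;> simp

theorem ClosedPath.average_leftForm (C : S.ClosedPath) (d : Dart F) :
    S.average C.leftForm d = C.leftCycle true (d.shift 1) + C.leftCycle false (d.shift 1) := by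
  -- Here `h (rev e) = diagChain e + h (rot e)`. Averaged path edges are written with the left side
  -- and averaged left edges with the right side; the `h` differences cancel by telescoping, and
  -- only the diagonals of the left cycles remain.
  let h : Dart F → ℂ := fun e =>
    (1 / 2) * (diagChain (S.rev e) d - diagChain ((S.rev e).shift 1) d)
  have hE : ∀ e, S.average (edgeChain S.rev e) d = h (S.rev e) - h e := fun e => by
    simp only [average_edgeChain, h, S.rev_rev, Pi.smul_apply, Pi.add_apply, Pi.sub_apply,
      smul_eq_mul]
    ring
  have hE' : ∀ e, S.average (edgeChain S.rev e) d = diagChain e d + (h (S.rot e) - h e) :=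
    fun e => by
    rw [hE]
    simp only [h, S.rev_rev, rev_rot, Dart.shift_shift, diagChain_shift_neg_one, Pi.neg_apply,
      show (-1 + 1 : ZMod 4) = 0 from rfl, Dart.shift_zero]
    ring
  have hL : ∀ e : Dart F, diagChain (e.shift (-1)) (d.shift 1) = -diagChain e d := fun e => by
    rw [diagChain_shift_neg_one, Pi.neg_apply, diagChain_shift]
  rw [← Pi.add_apply, C.leftCycle_add, ← averageLin_apply]
  simp only [leftForm, chain, map_sub, map_sum, Pi.sub_apply, Finset.sum_apply, averageLin_apply,
    hL, Finset.sum_neg_distrib]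
  rw [Finset.sum_congr rfl fun i _ => hE _, ← C.sum_sum_leftTurn_sub h, neg_eq_iff_eq_neg.2]
  simp only [← Finset.sum_sub_distrib, hE', sub_add_cancel_right, Finset.sum_neg_distrib, neg_neg]

end LeftForm

/-! ### Left cycles -/

section LeftCycle

variable {V F : Type*} {S : QuadGraph V F}

/-- The left cycle of colour `b` is supported by the diagonals of colour `b`. -/
theorem ClosedPath.leftCycle_eq_zero (C : S.ClosedPath) {b : Bool} {d : Dart F}
    (hd : S.color (S.src d) ≠ b) : C.leftCycle b d = 0 := by
  classical
  rw [leftCycle, Finset.sum_apply]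
  refine Finset.sum_eq_zero fun i _ => ?_
  split_ifs with hi
  · rfl
  rw [Finset.sum_apply]
  refine Finset.sum_eq_zero fun n _ => ?_
  have hc : S.color (S.src ((S.rot^[n] (C.dart (i + 1))).shift (-1))) = b := by
    rw [color_shift_neg_one, src_rot_iterate, C.color_succ]
    exact (Bool.eq_not.2 (Ne.symm hi)).symm
  rw [edgeChain_apply, if_neg, if_neg, sub_zero]
  · rintro rfl
    exact hd (by rw [color_shift_two, hc])
  · rintro rfl
    exact hd hc

/-- The closed form on `Λ` counting the crossings with the left cycle of colour `b`. -/
def ClosedPath.crossForm (C : S.ClosedPath) (b : Bool) (d : Dart F) : ℂ :=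
  C.leftCycle b (d.shift 1)

theorem ClosedPath.average_leftForm_eq (C : S.ClosedPath) :
    S.average C.leftForm = C.crossForm true + C.crossForm false :=
  funext C.average_leftForm

/-- The quarter turn `shift 1` swaps colours, so the two crossing forms have disjoint supports and
are the restrictions of the averaged `leftForm` to each colour. -/
theorem ClosedPath.crossForm_eq (C : S.ClosedPath) (b : Bool) (d : Dart F) :
    C.crossForm b d = if S.color (S.src d) = b then 0 else S.average C.leftForm d := by
  have h := S.color_shift_one d
  have ht := C.leftCycle_eq_zero (b := true) (d := d.shift 1)
  have hf := C.leftCycle_eq_zero (b := false) (d := d.shift 1)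
  rw [C.average_leftForm, crossForm]
  cases hc : S.color (S.src d) <;> cases b <;> simp_all

variable [Fintype F]

theorem ClosedPath.integral_leftCycle (C : S.ClosedPath) (b : Bool) {φ : Dart F → ℂ}
    (hφ : ∀ d : Dart F, φ (d.shift 2) = -φ d) :
    integral (C.leftCycle b) φ = ∑ i, if S.color (S.tgt (C.dart i)) = b then 0 else
      ∑ n ∈ Finset.range (leftTurn (S := S) (C.dart i) (C.dart (i + 1))),
        φ ((S.rot^[n] (C.dart (i + 1))).shift (-1)) := by
  change integralLin φ (C.leftCycle b) = _
  rw [leftCycle, map_sum]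
  refine Finset.sum_congr rfl fun i _ => ?_
  split_ifs
  · exact map_zero _
  · rw [map_sum]
    exact Finset.sum_congr rfl fun n _ => integral_edgeChain (r := fun d => d.shift 2) hφ _

theorem ClosedPath.integral_chain (C : S.ClosedPath) {θ : Dart F → ℂ}
    (hθ : ∀ d, θ (S.rev d) = -θ d) : integral C.chain θ = ∑ i, θ (C.dart i) := by
  change integralLin θ C.chain = _
  rw [chain, map_sum]
  exact Finset.sum_congr rfl fun i _ => integral_edgeChain hθ _

/-- The periods of the average of a closed form. -/
theorem ClosedPath.integral_leftCycle_average (C : S.ClosedPath) (b : Bool) {θ : Dart F → ℂ}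
    (hθ : S.IsDiamClosed θ) :
    integral (C.leftCycle b) (S.average θ) = integral C.chain θ := by
  have h : ∀ e : Dart F, S.average θ (e.shift (-1)) = -(θ (S.rot e) - θ e) := fun e => by
    rw [← hθ.average_shift_one, ← hθ.average_odd, Dart.shift_shift]
    rfl
  -- Each corner of colour other than `b` contributes its incoming and outgoing edges; every edge of
  -- the path has exactly one such end, so it is counted once.
  have h' : ∀ i, (if S.color (S.tgt (C.dart i)) = b then 0 else θ (C.dart i) + θ (C.dart (i + 1)))
      = (if S.color (S.src (C.dart i)) = b then θ (C.dart i) else 0) +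
        if S.color (S.src (C.dart (i + 1))) = b then 0 else θ (C.dart (i + 1)) := fun i => by
    rw [C.color_succ, color_tgt]
    cases S.color (S.src (C.dart i)) <;> cases b <;> simp
  rw [C.integral_leftCycle b hθ.average_odd, C.integral_chain hθ.1]
  simp only [h, Finset.sum_neg_distrib, C.sum_leftTurn_sub, hθ.1]
  simp only [neg_sub, sub_neg_eq_add, add_comm (θ (C.dart (_ + 1))), h', Finset.sum_add_distrib]
  rw [C.sum_succ fun i => if S.color (S.src (C.dart i)) = b then 0 else θ (C.dart i),
    ← Finset.sum_add_distrib]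
  refine Finset.sum_congr rfl fun i _ => ?_
  split_ifs <;> simp

/-- The boundary of a face of `Λ` has a single colour, so restricting a closed form to one colour
keeps it closed. -/
theorem ClosedPath.isLambdaClosed_crossForm (C : S.ClosedPath) (b : Bool) :
    S.IsLambdaClosed (C.crossForm b) := by
  classical
  have h := C.isDiamClosed_leftForm.average
  refine ⟨fun d => ?_, fun v => ?_⟩
  · rw [crossForm_eq, crossForm_eq, color_shift_two, h.1]
    split_ifs <;> simp
  · have hv := h.2 v
    rw [lambdaCoboundary] at hv ⊢
    by_cases hc : S.color v = b
    · rw [← hv]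
      refine Finset.sum_congr rfl fun d hd => ?_
      rw [crossForm_eq, color_shift_one, (Finset.mem_filter.1 hd).2, hc, if_neg (by simp)]
    · refine Finset.sum_eq_zero fun d hd => ?_
      rw [crossForm_eq, color_shift_one, (Finset.mem_filter.1 hd).2,
        if_pos (Bool.eq_not.2 (Ne.symm hc)).symm]

end LeftCycle

/-! ### Harmonic forms -/

section Harmonic

variable {V F : Type*} {S : QuadGraph V F}

/-- The exact form on `Λ` with a given potential. -/
def lambdaExact (S : QuadGraph V F) (f : V → ℂ) : Dart F → ℂ :=
  potentialDiff (fun d => d.shift 2) S.src f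

theorem ConformalStructure.rho_shift_two (R : S.ConformalStructure) (d : Dart F) :
    R.ρ (d.shift 2) = R.ρ d := by
  rw [show d.shift 2 = (d.shift 1).shift 1 from (d.shift_shift 1 1).symm, R.dual, R.dual,
    one_div_one_div]

theorem ConformalStructure.star_sub (R : S.ConformalStructure) (α β : Dart F → ℂ) :
    R.star (α - β) = R.star α - R.star β := by
  funext d
  simp [star]
  ring

theorem lambdaExact_add (f f' : V → ℂ) :
    S.lambdaExact (f + f') = S.lambdaExact f + S.lambdaExact f' := by
  funext d
  simp [lambdaExact, potentialDiff]
  ring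

theorem ConformalStructure.star_odd (R : S.ConformalStructure) {α : Dart F → ℂ}
    (hα : ∀ d : Dart F, α (d.shift 2) = -α d) (d : Dart F) :
    R.star α (d.shift 2) = -R.star α d := by
  have h : (d.shift 2).shift 1 = (d.shift 1).shift 2 := by
    simp only [Dart.shift_shift]
    rfl
  rw [star, star, h, hα, R.rho_shift_two]
  ring

variable [Fintype F]

theorem isLambdaClosed_lambdaExact (f : V → ℂ) : S.IsLambdaClosed (S.lambdaExact f) := by
  rw [lambdaExact, ← average_potentialDiff]
  exact (isDiamClosed_potentialDiff f).average

theorem IsLambdaClosed.sub {α β : Dart F → ℂ} (hα : S.IsLambdaClosed α)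
    (hβ : S.IsLambdaClosed β) : S.IsLambdaClosed (α - β) := by
  refine ⟨fun d => by simp [hα.1 d, hβ.1 d]; ring, fun v => ?_⟩
  have h := hα.2 v
  have h' := hβ.2 v
  simp only [lambdaCoboundary] at h h' ⊢
  simp [Finset.sum_sub_distrib, h, h']

/-- Co-closedness becomes vanishing `ρ`-weighted divergence at every vertex, the form used in the
graph lemmas. -/
theorem ConformalStructure.lambdaCoboundary_star (R : S.ConformalStructure) {α : Dart F → ℂ}
    (hα : ∀ d : Dart F, α (d.shift 2) = -α d) (v : V) [DecidablePred fun d => S.src d = v] :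
    S.lambdaCoboundary (R.star α) v = ∑ d with S.src d = v, (R.ρ d : ℂ) * α d := by
  simp only [lambdaCoboundary, star, Dart.shift_shift, show (1 + 1 : ZMod 4) = 2 from rfl, hα,
    R.rho_shift_two]
  refine Finset.sum_congr (by congr) fun d _ => by ring

/-- A harmonic form is determined by its periods. -/
theorem ConformalStructure.IsLambdaEta.unique {R : S.ConformalStructure} {c η η' : Dart F → ℂ}
    (h : R.IsLambdaEta c η) (h' : R.IsLambdaEta c η') : η = η' := by
  classical
  have hd := h.1.sub h'.1
  have hs := h.2.1.sub h'.2.1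
  rw [← R.star_sub] at hs
  refine sub_eq_zero.1 (eq_zero_of_coclosed (s := S.src) R.pos R.rho_shift_two hd.1
    (fun v => ?_) fun A hA hA' => ?_)
  · rw [← hs.2 v, R.lambdaCoboundary_star hd.1]
  · have hA2 : S.IsLambdaCycle A := ⟨hA, fun v => by
      rw [← hA' v, outflow]⟩
    have h1 := (h.2.2 A hA2).trans (h'.2.2 A hA2).symm
    simpa [integral, mul_sub, sub_eq_zero] using h1

variable [Fintype V]

theorem sum_mul_lambdaExact {A : Dart F → ℂ} (hA : S.IsLambdaCycle A) (f : V → ℂ) :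
    ∑ d, A d * S.lambdaExact f d = 0 := by
  classical
  have h := sum_potentialDiff_mul shift_two_involutive S.src f A hA.1
  have h0 : ∀ v, ∑ d with S.src d = v, A d = 0 := fun v => by
    rw [← hA.2 v, outflow]
  simp only [h0, mul_zero, Finset.sum_const_zero] at h
  rw [← h]
  exact Finset.sum_congr rfl fun d _ => mul_comm _ _

/-- Existence of the harmonic form with the periods of a closed form of crossings. -/
theorem ConformalStructure.exists_isLambdaEta (R : S.ConformalStructure) {c : Dart F → ℂ}
    (hc : S.IsLambdaClosed fun d => c (d.shift 1)) :
    ∃ f, R.IsLambdaEta c ((fun d => c (d.shift 1)) - S.lambdaExact f) := by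
  classical
  -- The rotated chain already has the crossing numbers as periods; subtracting its exact part makes
  -- it co-closed without changing them.
  obtain ⟨f, hf⟩ := exists_sub_potentialDiff_coclosed (β := fun d => c (d.shift 1))
    shift_two_involutive S.src R.pos R.rho_shift_two hc.1
  have h := hc.sub (isLambdaClosed_lambdaExact f)
  refine ⟨f, h, ⟨R.star_odd h.1, fun v => ?_⟩, fun A hA => ?_⟩
  · rw [R.lambdaCoboundary_star h.1, ← hf v]
    exact Finset.sum_congr (by congr) fun _ _ => rfl
  · simp only [integral, crossingNumber, Pi.sub_apply, mul_sub, Finset.sum_sub_distrib,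
      sum_mul_lambdaExact hA, sub_zero]

theorem ConformalStructure.exists_lambdaEta_leftCycle (R : S.ConformalStructure)
    (C : S.ClosedPath) (b : Bool) :
    ∃ f, R.lambdaEta (C.leftCycle b) = C.crossForm b - S.lambdaExact f := by
  obtain ⟨f, hf⟩ := R.exists_isLambdaEta (C.isLambdaClosed_crossForm b)
  exact ⟨f, (Classical.epsilon_spec ⟨_, hf⟩ :
    R.IsLambdaEta _ (R.lambdaEta (C.leftCycle b))).unique hf⟩

/-- The form `η_C` exists on the quad-graph, and its average is the form of crossings with the
left cycles, up to an exact form. -/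
theorem ConformalStructure.exists_average_diamEta (R : S.ConformalStructure) (C : S.ClosedPath) :
    S.IsDiamClosed (R.diamEta C) ∧
      ∃ f, S.average (R.diamEta C) = S.average C.leftForm - S.lambdaExact f := by
  obtain ⟨f, hf⟩ := R.exists_lambdaEta_leftCycle C true
  obtain ⟨f', hf'⟩ := R.exists_lambdaEta_leftCycle C false
  have havg : R.lambdaEta (C.leftCycle true) + R.lambdaEta (C.leftCycle false) =
      S.average C.leftForm - S.lambdaExact (f + f') := by
    rw [hf, hf', C.average_leftForm_eq, lambdaExact_add]
    abel
  -- Averaging commutes with the coboundary of a vertex function, so the potential found on `Λ` also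
  -- corrects `leftForm` on the quad-graph.
  have h : R.IsDiamEta C (C.leftForm - potentialDiff S.rev S.src (f + f')) := by
    refine ⟨S.diamClosed.sub_mem C.isDiamClosed_leftForm (isDiamClosed_potentialDiff _), ?_⟩
    rw [havg, ← averageLin_apply, map_sub, averageLin_apply, averageLin_apply,
      average_potentialDiff, lambdaExact]
  have h' : R.IsDiamEta C (R.diamEta C) := Classical.epsilon_spec ⟨_, h⟩
  exact ⟨h'.1, f + f', h'.2.trans havg⟩

end Harmonic

/-! ### Wedge products in terms of averages -/

section Pairing

variable {V F : Type*} {S : QuadGraph V F}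

theorem integral_comm [Fintype F] (c θ : Dart F → ℂ) : integral c θ = integral θ c := by
  simp only [integral, mul_comm]

/-- On one face a closed form is determined by three of its side values; eliminating the fourth
leaves a polynomial identity. -/
theorem IsDiamClosed.diamWedge_eq {α β : Dart F → ℂ} (hα : S.IsDiamClosed α)
    (hβ : S.IsDiamClosed β) (f : F) :
    S.diamWedge α β f = lambdaWedge (S.average α) (S.average β) f := by
  have h1 : (0 - 1 : ZMod 4) = 3 := rfl
  have h2 : (1 - 1 : ZMod 4) = 0 := rfl
  have h3 : (2 - 1 : ZMod 4) = 1 := rfl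
  have h4 : (3 - 1 : ZMod 4) = 2 := rfl
  have hs : ∀ k : ZMod 4, Dart.shift (f, k) 1 = (f, k + 1) := fun _ => rfl
  have ha := hα.2 f
  have hb := hβ.2 f
  rw [ZMod.sum_univ_four] at ha hb
  have ha3 : α (f, 3) = -(α (f, 0) + α (f, 1) + α (f, 2)) := by linear_combination ha
  have hb3 : β (f, 3) = -(β (f, 0) + β (f, 1) + β (f, 2)) := by linear_combination hb
  simp only [diamWedge, lambdaWedge, ZMod.sum_univ_four, hα.1, hβ.1, hα.average_eq,
    hβ.average_eq, hs, h1, h2, h3, h4, zero_add, show (1 + 1 : ZMod 4) = 2 from rfl,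
    show (2 + 1 : ZMod 4) = 3 from rfl, ha3, hb3]
  ring

theorem lambdaWedge_swap {α β : Dart F → ℂ} (hα : ∀ d : Dart F, α (d.shift 2) = -α d)
    (hβ : ∀ d : Dart F, β (d.shift 2) = -β d) (f : F) :
    lambdaWedge α β f = -lambdaWedge β α f := by
  have ha : α (f, 2) = -α (f, 0) := hα (f, 0)
  have hb : β (f, 2) = -β (f, 0) := hβ (f, 0)
  simp only [lambdaWedge, ha, hb]
  ring

variable [Fintype F]

/-- The contribution of the diagonals of colour `b` to the integral of a wedge product. -/
def colorPairing (S : QuadGraph V F) (b : Bool) (φ ψ : Dart F → ℂ) : ℂ :=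
  (1 / 4) * ∑ d : Dart F with S.color (S.src d) = b, φ d * ψ (d.shift 1)

theorem sum_lambdaWedge {φ ψ : Dart F → ℂ} (hφ : ∀ d : Dart F, φ (d.shift 2) = -φ d)
    (hψ : ∀ d : Dart F, ψ (d.shift 2) = -ψ d) :
    ∑ f, lambdaWedge φ ψ f = S.colorPairing true φ ψ + S.colorPairing false φ ψ := by
  have h : ∑ d : Dart F, φ d * ψ (d.shift 1) = 4 * ∑ f, lambdaWedge φ ψ f := by
    rw [Fintype.sum_prod_type, Finset.mul_sum]
    refine Finset.sum_congr rfl fun f _ => ?_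
    have h1 : φ (f, 2) = -φ (f, 0) := hφ (f, 0)
    have h2 : φ (f, 3) = -φ (f, 1) := hφ (f, 1)
    have h3 : ψ (f, 3) = -ψ (f, 1) := hψ (f, 1)
    have h4 : ψ (f, 0) = -ψ (f, 2) := hψ (f, 2)
    simp only [ZMod.sum_univ_four, Dart.shift, lambdaWedge, zero_add,
      show (1 + 1 : ZMod 4) = 2 from rfl, show (2 + 1 : ZMod 4) = 3 from rfl,
      show (3 + 1 : ZMod 4) = 0 from rfl, h1, h2, h3, h4]
    ring
  have h' := Finset.sum_filter_add_sum_filter_not Finset.univ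
    (fun d : Dart F => S.color (S.src d) = true) fun d => φ d * ψ (d.shift 1)
  simp only [Bool.not_eq_true] at h'
  rw [h] at h'
  rw [colorPairing, colorPairing, ← mul_add, h']
  ring

/-- The pairing as a linear function of the first form. -/
def colorPairingLin (S : QuadGraph V F) (b : Bool) (ψ : Dart F → ℂ) : (Dart F → ℂ) →ₗ[ℂ] ℂ where
  toFun φ := S.colorPairing b φ ψ
  map_add' φ φ' := by simp [colorPairing, add_mul, Finset.sum_add_distrib, mul_add]
  map_smul' c φ := by simp [colorPairing, mul_assoc, Finset.mul_sum, mul_left_comm]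

theorem colorPairing_congr {b : Bool} {φ φ' ψ ψ' : Dart F → ℂ}
    (hφ : ∀ d, S.color (S.src d) = b → φ d = φ' d)
    (hψ : ∀ d, S.color (S.src d) = !b → ψ d = ψ' d) :
    S.colorPairing b φ ψ = S.colorPairing b φ' ψ' := by
  rw [colorPairing, colorPairing]
  congr 1
  refine Finset.sum_congr rfl fun d hd => ?_
  have hc := (Finset.mem_filter.1 hd).2
  rw [hφ d hc, hψ _ (by rw [color_shift_one, hc])]

/-- Stokes' formula for one colour: summing by parts leaves, at each vertex of colour `b`, the
coboundary of `ψ` on its dual face. -/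
theorem colorPairing_lambdaExact [Fintype V] (b : Bool) (f : V → ℂ) {ψ : Dart F → ℂ}
    (hψ : S.IsLambdaClosed ψ) : S.colorPairing b (S.lambdaExact f) ψ = 0 := by
  classical
  have h := sum_potentialDiff_mul shift_two_involutive S.src f
    (fun d => if S.color (S.src d) = b then ψ (d.shift 1) else 0) fun d => by
      simp only [color_shift_two, Dart.shift_shift]
      rw [show (2 + 1 : ZMod 4) = 1 + 2 from rfl, ← Dart.shift_shift, hψ.1]
      split_ifs <;> simp
  have h0 : ∀ v, ∑ d with S.src d = v,
      (if S.color (S.src d) = b then ψ (d.shift 1) else 0) = 0 := fun v => by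
    by_cases hv : S.color v = b
    · rw [← hψ.2 v, lambdaCoboundary]
      exact Finset.sum_congr rfl fun d hd => by rw [(Finset.mem_filter.1 hd).2, if_pos hv]
    · exact Finset.sum_eq_zero fun d hd => by rw [(Finset.mem_filter.1 hd).2, if_neg hv]
  simp only [h0, mul_ite, mul_zero, Finset.sum_const_zero] at h
  rw [colorPairing, Finset.sum_filter, lambdaExact, h, mul_zero]

/-- On diagonals of colour `b`, the averaged `leftForm` is the rotated left cycle of colour `!b`,
along which the average of `θ` has the period of `θ` along `C`. -/
theorem ClosedPath.colorPairing_leftForm (C : S.ClosedPath) (b : Bool) {θ : Dart F → ℂ}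
    (hθ : S.IsDiamClosed θ) :
    S.colorPairing b (S.average C.leftForm) (S.average θ) = (1 / 2) * integral C.chain θ := by
  rw [← C.integral_leftCycle_average (!b) hθ, integral, colorPairing, Finset.sum_filter,
    
    ← Dart.sum_shift 1 (fun d => C.leftCycle (!b) d * S.average θ d), ← mul_assoc]
  congr 1
  · norm_num
  refine Finset.sum_congr rfl fun d _ => ?_
  have h := C.crossForm_eq (!b) d
  rw [crossForm] at h
  rw [h]
  cases S.color (S.src d) <;> cases b <;> simp

variable [Fintype V]

theorem ClosedPath.colorPairing_of_average (C : S.ClosedPath) (b : Bool) {φ θ : Dart F → ℂ}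
    {f : V → ℂ} (hφ : φ = S.average C.leftForm - S.lambdaExact f) (hθ : S.IsDiamClosed θ) :
    S.colorPairing b φ (S.average θ) = (1 / 2) * integral C.chain θ := by
  change S.colorPairingLin b (S.average θ) φ = _
  rw [hφ, map_sub]
  change S.colorPairing b _ _ - S.colorPairing b _ _ = _
  rw [colorPairing_lambdaExact b f hθ.average, sub_zero, C.colorPairing_leftForm b hθ]

/-- Wedging with `η_C` is integrating along `C`. -/
theorem ConformalStructure.sum_diamWedge_diamEta (R : S.ConformalStructure) (C : S.ClosedPath)
    {θ : Dart F → ℂ} (hθ : S.IsDiamClosed θ) :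
    ∑ f, S.diamWedge (R.diamEta C) θ f = integral C.chain θ := by
  obtain ⟨hη, f, hf⟩ := R.exists_average_diamEta C
  simp only [hη.diamWedge_eq hθ]
  rw [sum_lambdaWedge (S := S) hη.average_odd hθ.average_odd, C.colorPairing_of_average true hf hθ,
    C.colorPairing_of_average false hf hθ]
  ring

theorem ConformalStructure.integral_diamEta (R : S.ConformalStructure) (B C : S.ClosedPath) :
    integral B.chain (R.diamEta C) = R.intersection B C :=
  (R.sum_diamWedge_diamEta B (R.exists_average_diamEta C).1).symm

theorem ConformalStructure.intersection_swap (R : S.ConformalStructure) (B C : S.ClosedPath) :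
    R.intersection B C = -R.intersection C B := by
  have hB := (R.exists_average_diamEta B).1
  have hC := (R.exists_average_diamEta C).1
  rw [intersection, intersection, ← Finset.sum_neg_distrib]
  refine Finset.sum_congr rfl fun f _ => ?_
  rw [hB.diamWedge_eq hC, hC.diamWedge_eq hB, lambdaWedge_swap hB.average_odd hC.average_odd]

end Pairing

/-! ### Periods -/

section Periods

variable {V F : Type*} [Fintype F] {S : QuadGraph V F}

theorem integralLin_eq_zero_of_mem_diamBoundaries {θ : Dart F → ℂ} (hθ : S.IsDiamClosed θ)
    {c : Dart F → ℂ} (hc : c ∈ S.diamBoundaries) : integralLin θ c = 0 := by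
  suffices h : S.diamBoundaries ≤ LinearMap.ker (integralLin θ) from h hc
  refine Submodule.span_le.2 ?_
  rintro _ ⟨f, rfl⟩
  change integralLin θ _ = 0
  rw [map_sum, ← hθ.2 f]
  exact Finset.sum_congr rfl fun k _ => integral_edgeChain hθ.1 _

variable [Fintype V] {R : S.ConformalStructure} {g : ℕ}

/-- A closed form without periods along the cycles of a dissection is exact. -/
theorem CanonicalDissection.exists_eq_potentialDiff (A : CanonicalDissection R g)
    {θ : Dart F → ℂ} (hθ : S.IsDiamClosed θ)
    (h : ∀ k, integral (A.cycle k).chain θ = 0) :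
    ∃ f, θ = potentialDiff S.rev S.src f := by
  -- Integration descends to the quotient by boundaries and vanishes on a spanning set of the
  -- homology, hence on every cycle.
  let L : ((Dart F → ℂ) ⧸ S.diamBoundaries) →ₗ[ℂ] ℂ :=
    S.diamBoundaries.liftQ (integralLin θ) fun c hc =>
      integralLin_eq_zero_of_mem_diamBoundaries hθ hc
  have hL : S.diamHomology ≤ LinearMap.ker L := by
    rw [← A.span_eq, Submodule.span_le]
    rintro _ ⟨k, rfl⟩
    exact h k
  refine QuadGraph.exists_eq_potentialDiff S.rev_involutive S.src hθ.1 fun z hz hz' => ?_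
  have hm : S.diamBoundaries.mkQ z ∈ S.diamHomology :=
    Submodule.mem_map_of_mem ⟨hz, fun v => by rw [← hz' v, outflow]⟩
  have h0 : integral z θ = 0 := hL hm
  simpa [integral] using h0

/-- The average of a closed form as a combination of the forms crossing the cycles of a
dissection, up to an exact form. -/
theorem CanonicalDissection.exists_average_eq (A : CanonicalDissection R g)
    {θ : Dart F → ℂ} (hθ : S.IsDiamClosed θ) :
    ∃ f, S.average θ = ∑ j, (integral (A.cycle (.inl j)).chain θ •
        S.average (R.diamEta (A.cycle (.inr j))) -
      integral (A.cycle (.inr j)).chain θ • S.average (R.diamEta (A.cycle (.inl j)))) +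
      S.lambdaExact f := by
  have hη := fun k => (R.exists_average_diamEta (A.cycle k)).1
  -- The period of `η_l` along the `k`-th cycle is their intersection number, which is
  -- antisymmetric; these coefficients and signs invert the symplectic matrix, so `σ` has the
  -- periods of `θ`.
  let σ : Dart F → ℂ := ∑ j, (integral (A.cycle (.inl j)).chain θ • R.diamEta (A.cycle (.inr j)) -
    integral (A.cycle (.inr j)).chain θ • R.diamEta (A.cycle (.inl j)))
  have hσ : σ ∈ S.diamClosed := S.diamClosed.sum_mem fun j _ => S.diamClosed.sub_mem
    (S.diamClosed.smul_mem _ (hη _)) (S.diamClosed.smul_mem _ (hη _))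
  have hp : ∀ k, integral (A.cycle k).chain σ = integral (A.cycle k).chain θ := fun k => by
    rw [integral_comm]
    change integralLin _ σ = _
    simp only [σ, map_sum, map_sub, map_smul]
    have he : ∀ l, integralLin (A.cycle k).chain (R.diamEta (A.cycle l)) =
        R.intersection (A.cycle k) (A.cycle l) := fun l => by
      rw [← R.integral_diamEta, integral_comm]
      rfl
    simp only [he, smul_eq_mul]
    rcases k with k | k
    · simp [A.inl_inl, A.inl_inr]
    · simp [A.inr_inr, R.intersection_swap (A.cycle (.inr k)) (A.cycle (.inl _)), A.inl_inr]
  obtain ⟨f, hf⟩ := A.exists_eq_potentialDiff (S.diamClosed.sub_mem hθ hσ) fun k => by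
    rw [integral_comm]
    change integralLin _ (θ - σ) = 0
    rw [map_sub]
    change integral θ _ - integral σ _ = 0
    rw [integral_comm, integral_comm σ, hp, sub_self]
  refine ⟨f, ?_⟩
  rw [lambdaExact, ← average_potentialDiff, ← hf]
  simp only [← averageLin_apply, ← map_smul, ← map_sub, ← map_sum]
  rw [map_sub, add_sub_cancel]

/-- The bilinear relation on the quad-graph, for the diagonals of one colour. -/
theorem CanonicalDissection.colorPairing_average (A : CanonicalDissection R g) (b : Bool)
    {θ θ' : Dart F → ℂ} (hθ : S.IsDiamClosed θ) (hθ' : S.IsDiamClosed θ') :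
    S.colorPairing b (S.average θ) (S.average θ') = (1 / 2) * ∑ j : Fin g,
      (integral (A.cycle (.inl j)).chain θ * integral (A.cycle (.inr j)).chain θ' -
        integral (A.cycle (.inr j)).chain θ * integral (A.cycle (.inl j)).chain θ') := by
  obtain ⟨f, hf⟩ := A.exists_average_eq hθ
  have hc : ∀ k, S.colorPairingLin b (S.average θ') (S.average (R.diamEta (A.cycle k))) =
      (1 / 2) * integral (A.cycle k).chain θ' := fun k => by
    obtain ⟨_, f', hf'⟩ := R.exists_average_diamEta (A.cycle k)
    exact (A.cycle k).colorPairing_of_average b hf' hθ'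
  have hx : S.colorPairingLin b (S.average θ') (S.lambdaExact f) = 0 :=
    colorPairing_lambdaExact b f hθ'.average
  change S.colorPairingLin b (S.average θ') (S.average θ) = _
  rw [hf, map_add, hx, add_zero, map_sum, Finset.mul_sum]
  refine Finset.sum_congr rfl fun j _ => ?_
  rw [map_sub, map_smul, map_smul, hc, hc, smul_eq_mul, smul_eq_mul]
  ring

end Periods

/-! ### Lifting closed forms on one of the two graphs -/

section Lift

variable {V F : Type*} (S : QuadGraph V F)

theorem mem_periodicPts_rot (d : Dart F) : d ∈ Function.periodicPts S.rot := by
  obtain ⟨n, hn⟩ := S.exists_rot_iterate (S.src_rot d)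
  exact Function.mk_mem_periodicPts n.succ_pos hn

open scoped Classical in
theorem sum_rot_iterate [Fintype F] (ψ : Dart F → ℂ) (d : Dart F) :
    ∑ m ∈ Finset.range (Function.minimalPeriod S.rot d), ψ (S.rot^[m] d) =
      ∑ e with S.src e = S.src d, ψ e := by
  have hp := Function.minimalPeriod_pos_of_mem_periodicPts (S.mem_periodicPts_rot d)
  refine Finset.sum_nbij (fun m => S.rot^[m] d) (fun m _ => ?_) (fun m hm n hn h => ?_)
    (fun e he => ?_) fun _ _ => rfl
  · simp [src_rot_iterate]
  · exact Function.iterate_injOn_Iio_minimalPeriod (by simpa using hm) (by simpa using hn) h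
  · obtain ⟨n, hn⟩ := S.exists_rot_iterate (Finset.mem_filter.1 he).2.symm
    exact ⟨n % Function.minimalPeriod S.rot d, by simpa using Nat.mod_lt _ hp,
      by rw [← hn]; exact Function.iterate_mod_minimalPeriod_eq⟩

open scoped Classical in
/-- A form on the edges around each vertex, with sum zero, has a primitive around each vertex. -/
theorem exists_rot_primitive [Fintype F] {ψ : Dart F → ℂ}
    (hψ : ∀ v, ∑ d with S.src d = v, ψ d = 0) :
    ∃ h : Dart F → ℂ, ∀ d, h (S.rot d) - h d = ψ d := by
  -- This weighted mean over the orbit needs no choice of a base dart. By Abel summation its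
  -- increment is `ψ d` minus the mean of `ψ` over the orbit, which vanishes.
  refine ⟨fun d => (1 / (Function.minimalPeriod S.rot d : ℂ)) *
    ∑ m ∈ Finset.range (Function.minimalPeriod S.rot d), (m : ℂ) * ψ (S.rot^[m] d), fun d => ?_⟩
  have hm := S.mem_periodicPts_rot d
  have hp := Function.minimalPeriod_pos_of_mem_periodicPts hm
  have h0 := S.sum_rot_iterate ψ d
  have hd : S.rot^[Function.minimalPeriod S.rot d] d = d := Function.iterate_minimalPeriod
  rw [hψ] at h0
  simp only [Function.minimalPeriod_apply hm, ← Function.iterate_succ_apply]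
  generalize Function.minimalPeriod S.rot d = p at *
  have hp' : (p : ℂ) ≠ 0 := by exact_mod_cast hp.ne'
  have h1 := Finset.sum_range_sub (fun m => (m : ℂ) * ψ (S.rot^[m] d)) p
  have h2 := Finset.sum_range_sub (fun m => ψ (S.rot^[m] d)) p
  simp only [Finset.sum_sub_distrib, Nat.cast_add, Nat.cast_one, add_mul, one_mul,
    Finset.sum_add_distrib, hd, Nat.cast_zero, zero_mul, sub_zero, Function.iterate_zero_apply]
    at h1 h2
  field_simp
  linear_combination h1 - h2 - h0

variable {S} [Fintype F]

/-- A closed form on `Λ` is, on the diagonals of one colour, the average of a closed form on the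
quad-graph. -/
theorem IsLambdaClosed.exists_average_eq {φ : Dart F → ℂ} (hφ : S.IsLambdaClosed φ) (b : Bool) :
    ∃ θ, S.IsDiamClosed θ ∧ ∀ d, S.color (S.src d) = b → S.average θ d = φ d := by
  obtain ⟨h, hh⟩ := S.exists_rot_primitive (ψ := fun d => φ (d.shift 1)) hφ.2
  -- Each edge has one end of colour other than `b`: the primitive around that end fixes its value,
  -- and oddness the opposite orientation. A face has two such corners, whose contributions cancel
  -- because `φ` is odd.
  let θ : Dart F → ℂ := fun d => if S.color (S.src d) = b then -h (S.rev d) else h d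
  have hθ1 : ∀ d, θ (S.rev d) = -θ d := fun d => by
    simp only [θ, src_rev, color_tgt, S.rev_rev]
    cases S.color (S.src d) <;> cases b <;> simp
  have hθ2 : ∀ d, S.color (S.src d) ≠ b → θ d + θ (d.shift 3) = -φ (d.shift 1) := fun d hd => by
    have h3 : θ (d.shift 3) = -θ (S.rot d) := by
      rw [← hθ1, rev_rot]
      rfl
    have h4 : θ d = h d := if_neg hd
    have h5 : θ (S.rot d) = h (S.rot d) := if_neg (by rwa [src_rot])
    rw [h3, h4, h5]
    linear_combination -hh d
  have hsum : ∀ d, S.color (S.src d) ≠ b →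
      θ d + θ (d.shift 1) + θ (d.shift 2) + θ (d.shift 3) = 0 := fun d hd => by
    have h1 := hθ2 d hd
    have h2 := hθ2 (d.shift 2) (by rwa [color_shift_two])
    have h3 := hφ.1 (d.shift 1)
    simp only [Dart.shift_shift, show (2 + 3 : ZMod 4) = 1 from rfl,
      show (2 + 1 : ZMod 4) = 3 from rfl, show (1 + 2 : ZMod 4) = 3 from rfl] at h2 h3
    linear_combination h1 + h2 - h3
  have hcl : S.IsDiamClosed θ := isDiamClosed_of_shift hθ1 fun d => by
    by_cases hd : S.color (S.src d) = b
    · have h1 := hsum (d.shift 1) (by rw [color_shift_one, hd]; simp)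
      simp only [Dart.shift_shift, show (1 + 1 : ZMod 4) = 2 from rfl,
        show (1 + 2 : ZMod 4) = 3 from rfl, show (1 + 3 : ZMod 4) = 0 from rfl,
        Dart.shift_zero] at h1
      linear_combination h1
    · exact hsum d hd
  refine ⟨θ, hcl, fun d hd => ?_⟩
  have h1 := hθ2 (d.shift 1) (by rw [color_shift_one, hd]; simp)
  rw [Dart.shift_shift, Dart.shift_shift, show (1 + 3 : ZMod 4) = 0 from rfl,
    show (1 + 1 : ZMod 4) = 2 from rfl, Dart.shift_zero, hφ.1] at h1
  rw [hcl.average_eq]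
  linear_combination h1

theorem ClosedPath.integral_leftCycle_of_average_eq (C : S.ClosedPath) {b : Bool}
    {φ θ : Dart F → ℂ} (hθ : S.IsDiamClosed θ)
    (h : ∀ d, S.color (S.src d) = b → S.average θ d = φ d) :
    integral (C.leftCycle b) φ = integral C.chain θ := by
  rw [← C.integral_leftCycle_average b hθ, integral, integral]
  congr 1
  refine Finset.sum_congr rfl fun d _ => ?_
  by_cases hd : S.color (S.src d) = b
  · rw [h d hd]
  · rw [C.leftCycle_eq_zero hd, zero_mul, zero_mul]

end Lift

end QuadGraph

end

/-! ### The two bilinear relations. -/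

theorem mainTheorem4 {V F : Type*} [Fintype V] [Fintype F] (S : QuadGraph V F)
    (R : S.ConformalStructure) (g : ℕ) (hg : S.HasGenus g)
    (A : QuadGraph.CanonicalDissection R g) :
    (∀ θ θ' : Dart F → ℂ, S.IsDiamClosed θ → S.IsDiamClosed θ' →
      ∑ f, S.diamWedge θ θ' f =
        ∑ j : Fin g,
          (QuadGraph.integral (A.cycle (.inl j)).chain θ *
              QuadGraph.integral (A.cycle (.inr j)).chain θ' -
            QuadGraph.integral (A.cycle (.inr j)).chain θ *
              QuadGraph.integral (A.cycle (.inl j)).chain θ')) ∧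
    (∀ θ θ' : Dart F → ℂ, S.IsLambdaClosed θ → S.IsLambdaClosed θ' →
      ∑ f, QuadGraph.lambdaWedge θ θ' f =
        (1 / 2) * ∑ j : Fin g ⊕ Fin g,
          (QuadGraph.integral (A.lambdaCycle (.inl j)) θ *
              QuadGraph.integral (A.lambdaCycle (.inr j)) θ' -
            QuadGraph.integral (A.lambdaCycle (.inr j)) θ *
              QuadGraph.integral (A.lambdaCycle (.inl j)) θ')) := by
  constructor
  · intro θ θ' hθ hθ'
    simp only [hθ.diamWedge_eq hθ']
    rw [QuadGraph.sum_lambdaWedge (S := S) hθ.average_odd hθ'.average_odd,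
      A.colorPairing_average true hθ hθ', A.colorPairing_average false hθ hθ']
    ring
  · intro φ φ' hφ hφ'
    obtain ⟨θt, ht, hφt⟩ := hφ.exists_average_eq true
    obtain ⟨θf, hf, hφf⟩ := hφ.exists_average_eq false
    obtain ⟨θt', ht', hφt'⟩ := hφ'.exists_average_eq true
    obtain ⟨θf', hf', hφf'⟩ := hφ'.exists_average_eq false
    -- Each half pairs `φ` on one colour with `φ'` on the other, hence the crossed lifts `θt, θf'`
    -- and `θf, θt'`. The order of `lambdaCycle` likewise matches each cycle with one on the other
    -- graph.
    rw [QuadGraph.sum_lambdaWedge (S := S) hφ.1 hφ'.1,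
      ← QuadGraph.colorPairing_congr hφt hφf', ← QuadGraph.colorPairing_congr hφf hφt',
      A.colorPairing_average true ht hf', A.colorPairing_average false hf ht',
      Fintype.sum_sum_type, ← mul_add]
    simp only [QuadGraph.CanonicalDissection.lambdaCycle,
      (A.cycle _).integral_leftCycle_of_average_eq ht hφt,
      (A.cycle _).integral_leftCycle_of_average_eq hf hφf,
      (A.cycle _).integral_leftCycle_of_average_eq ht' hφt',
      (A.cycle _).integral_leftCycle_of_average_eq hf' hφf']
    simp only [Finset.sum_sub_distrib]
    ring
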